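/- Let $d \ge 1$ and $k \ge 0$ be integers. Call a set $A \subseteq \mathbb{R}^d$ a thin Delone set if every closed ball contains only finitely many points of $A$ and every closed half-space contains at least one point of $A$. Call $A$ generic if no $d+1$ of its points lie on a common hyperplane and no $d+2$ of its points lie on a common $(d-1)$-sphere, and call a point $x \in \mathbb{R}^d$ generic with respect to $A$ if $x \notin A$ and $A \cup \{x\}$ is generic. A $d$-simplex (the convex hull of $d+1$ affinely independent points) with vertices in $A$ is a $k$-hefty simplex of $A$ if exactly $k$ points of $A$ lie strictly inside its circumscribed sphere. Let $A \subseteq \mathbb{R}^d$ be a generic thin Delone set. Then every point $x \in \mathbb{R}^d$ that is generic with respect to $A$ belongs to exactly $\binom{d+k}{d}$ $k$-hefty simplices of $A$. -/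

import Mathlib

/-- `A` is locally finite: every closed ball contains only finitely many points of `A`. -/
def IsLocallyFinite {d : ℕ} (A : Set (EuclideanSpace ℝ (Fin d))) : Prop :=
  ∀ (c : EuclideanSpace ℝ (Fin d)) (r : ℝ), (A ∩ Metric.closedBall c r).Finite

/-- `A` is coarsely dense: every closed half-space contains a point of `A`. -/
def IsCoarselyDense {d : ℕ} (A : Set (EuclideanSpace ℝ (Fin d))) : Prop :=
  ∀ (u : EuclideanSpace ℝ (Fin d)) (c : ℝ), u ≠ 0 → ∃ a ∈ A, c ≤ inner ℝ u a

/-- A thin Delone set is a set that is locally finite and coarsely dense. -/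
structure IsThinDelone {d : ℕ} (A : Set (EuclideanSpace ℝ (Fin d))) : Prop where
  locallyFinite : IsLocallyFinite A
  coarselyDense : IsCoarselyDense A

/-- `A` is generic: no `d + 1` of its points lie on a common hyperplane, and no `d + 2` of its
points lie on a common `(d - 1)`-sphere. -/
structure IsGeneric {d : ℕ} (A : Set (EuclideanSpace ℝ (Fin d))) : Prop where
  hyperplane : ∀ S : Finset (EuclideanSpace ℝ (Fin d)), (S : Set _) ⊆ A → S.card = d + 1 →
    ∀ (u : EuclideanSpace ℝ (Fin d)) (c : ℝ), u ≠ 0 → ¬ ∀ p ∈ S, inner ℝ u p = c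
  sphere : ∀ S : Finset (EuclideanSpace ℝ (Fin d)), (S : Set _) ⊆ A → S.card = d + 2 →
    ∀ (z : EuclideanSpace ℝ (Fin d)) (r : ℝ), 0 < r → ¬ ∀ p ∈ S, p ∈ Metric.sphere z r

/-- `x` is generic with respect to `A`: it is not in `A`, and `A ∪ {x}` is generic. -/
def IsGenericWrt {d : ℕ} (x : EuclideanSpace ℝ (Fin d)) (A : Set (EuclideanSpace ℝ (Fin d))) :
    Prop :=
  x ∉ A ∧ IsGeneric (A ∪ {x})

/-- The `d`-simplex `T` is a `k`-hefty simplex of `A`: its vertices belong to `A`, and exactly `k`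
points of `A` lie (strictly) inside its circumscribed sphere. -/
def IsHefty {d : ℕ} (A : Set (EuclideanSpace ℝ (Fin d))) (k : ℕ)
    (T : Affine.Simplex ℝ (EuclideanSpace ℝ (Fin d)) d) : Prop :=
  Set.range T.points ⊆ A ∧ (A ∩ Metric.ball T.circumcenter T.circumradius).encard = k

/-- The `k`-hefty simplices of `A` that contain `x`, each one represented by its set of vertices,
so that orderings of the same vertices are not distinguished. A simplex is the convex hull of its
vertices, hence closed. -/
def heftySimplicesContaining {d : ℕ} (A : Set (EuclideanSpace ℝ (Fin d))) (k : ℕ)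
    (x : EuclideanSpace ℝ (Fin d)) : Set (Set (EuclideanSpace ℝ (Fin d))) :=
  {V | ∃ T : Affine.Simplex ℝ (EuclideanSpace ℝ (Fin d)) d,
    Set.range T.points = V ∧ IsHefty A k T ∧ x ∈ convexHull ℝ V}

/-!
Everything reduces to Delaunay's theorem, the case `k = 0`, applied to all sets `A \ F` with `F`
finite. Record a simplex that contains `x` as a pair `(B, I)`, where `B` is its vertex set and `I`
the finite set of points of `A` inside its circumscribed sphere. Its simplex is a Delaunay simplex
of `A \ F` exactly when `I ⊆ F` and `B` is disjoint from `F`. Removing a finite set keeps a thin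
Delone set thin Delone, so for every finite `F` there is exactly one such pair
(`isEmptySphereFamily_heftyPairs`).

This property alone determines the number `n_k` of pairs with `I.card = k`. If every point is put
into `F` independently with probability `t`, then the pair `(B, I)` is the selected one with
probability `t ^ k * (1 - t) ^ (d + 1)`, so `∑ n_k t ^ k = (1 - t) ^ (-(d + 1))`, whose coefficients
are `(d + k).choose d`. In `IsEmptySphereFamily.card_eq_choose` the probabilities are replaced by
counting the subsets `F` of size `k` of a large finite set.

Existence of the Delaunay simplex (`IsThinDelone.exists_empty_sphere`): among the spheres with no
point of `A` inside, one with the least power at `x` has `x` in the convex hull of the points of `A`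
on it; by Carathéodory and genericity `d + 1` of these points span a simplex containing `x`.
Uniqueness (`IsGeneric.eq_of_empty_spheres`): the difference of the powers with respect to two empty
spheres is affine, is nonnegative at the points on one and nonpositive at the points on the other.
Both convex hulls contain `x`, so it vanishes at `x`, and then at all vertices of the first simplex,
which therefore lie on the second sphere as well.
-/

/-! ### Counting the members of a family selected by finite sets -/

/-- The coefficient of `X ^ k` in `(1 - X)⁻¹ ^ (d + 1) * (1 - X)⁻¹ ^ (e + 1)`. -/
theorem sum_antidiagonal_choose_mul_choose (d e k : ℕ) :
    ∑ p ∈ Finset.HasAntidiagonal.antidiagonal k, (d + p.1).choose d * (e + p.2).choose e =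
      (d + e + 1 + k).choose k := by
  have h := congrArg (PowerSeries.coeff (R := ℤ) k)
    (congrArg Units.val (PowerSeries.invOneSubPow_add ℤ (d + 1) (e + 1)))
  rw [show d + 1 + (e + 1) = (d + e + 1) + 1 by ring, Units.val_mul,
    PowerSeries.invOneSubPow_val_succ_eq_mk_add_choose,
    PowerSeries.invOneSubPow_val_succ_eq_mk_add_choose,
    PowerSeries.invOneSubPow_val_succ_eq_mk_add_choose, PowerSeries.coeff_mul] at h
  simp only [PowerSeries.coeff_mk] at h
  rw [show (d + e + 1 + k).choose k = (d + e + 1 + k).choose (d + e + 1) from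
    Nat.choose_symm_of_eq_add (by ring)]
  exact_mod_cast h.symm

/-- An abstract form of the family of circumscribed spheres around a fixed point: a pair `(B, I)`
records the points `B` on a sphere and the points `I` inside it. The condition `existsUnique` says
that, after the removal of any finite set `F` of points, exactly one of the spheres is empty and
still has all its points `B`. -/
structure IsEmptySphereFamily {α : Type*} (n : ℕ) (P : Set (Finset α × Finset α)) : Prop where
  card_fst : ∀ p ∈ P, p.1.card = n
  disjoint : ∀ p ∈ P, Disjoint p.1 p.2
  existsUnique : ∀ F : Finset α, ∃! p, p ∈ P ∧ p.2 ⊆ F ∧ Disjoint p.1 F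

namespace IsEmptySphereFamily

variable {α : Type*} {n : ℕ} {P : Set (Finset α × Finset α)}

theorem eq_of_mem (h : IsEmptySphereFamily n P) {p q : Finset α × Finset α} (hp : p ∈ P)
    (hq : q ∈ P) (hsub : q.2 ⊆ p.2) (hdisj : Disjoint q.1 p.2) : q = p :=
  (h.existsUnique p.2).unique ⟨hq, hsub, hdisj⟩ ⟨hp, subset_rfl, h.disjoint p hp⟩

/-- Starting from `∅`, the set `I` of any member can be built up by adding points one at a time, each
taken from the `B` that is selected by the points added before: if that `B` were disjoint from `I`,
its pair would also be selected by `I`. As `B` is finite, there are finitely many ways to do so. -/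
theorem exists_finset_subset_snd (h : IsEmptySphereFamily n P) (j : ℕ) :
    ∃ 𝒯 : Finset (Finset α), ∀ p ∈ P, j ≤ p.2.card → ∃ F ∈ 𝒯, F ⊆ p.2 ∧ F.card = j := by
  classical
  induction j with
  | zero => exact ⟨{∅}, fun p _ _ => ⟨∅, by simp⟩⟩
  | succ j ih =>
    obtain ⟨𝒯, h𝒯⟩ := ih
    choose G hG _ using h.existsUnique
    refine ⟨𝒯.biUnion fun F => (G F).1.image fun b => insert b F, fun p hp hj => ?_⟩
    obtain ⟨F, hF, hFp, hFj⟩ := h𝒯 p hp (by omega)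
    obtain ⟨hGP, hGF, hGd⟩ := hG F
    have hnd : ¬ Disjoint (G F).1 p.2 := fun hd => by
      have := Finset.card_le_card hGF
      rw [h.eq_of_mem hp hGP (hGF.trans hFp) hd] at this
      omega
    obtain ⟨b, hb, hbp⟩ := Finset.not_disjoint_iff.1 hnd
    refine ⟨insert b F, ?_, Finset.insert_subset hbp hFp, ?_⟩
    · simp only [Finset.mem_biUnion, Finset.mem_image]
      exact ⟨F, hF, b, hb, rfl⟩
    · rw [Finset.card_insert_of_notMem (Finset.disjoint_left.1 hGd hb), hFj]

theorem finite_card_eq (h : IsEmptySphereFamily n P) (j : ℕ) :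
    {p ∈ P | p.2.card = j}.Finite := by
  obtain ⟨𝒯, h𝒯⟩ := h.exists_finset_subset_snd j
  refine Set.Finite.of_finite_image (f := Prod.snd) (𝒯.finite_toSet.subset ?_) ?_
  · rintro _ ⟨p, ⟨hp, hj⟩, rfl⟩
    obtain ⟨F, hF, hFp, hFj⟩ := h𝒯 p hp hj.ge
    rwa [← Finset.eq_of_subset_of_card_le hFp (by omega)]
  · rintro p ⟨hp, -⟩ q ⟨hq, -⟩ hpq
    exact (h.eq_of_mem hq hp hpq.subset (by simpa [← hpq] using h.disjoint p hp))

theorem card_filter_subset_disjoint [DecidableEq α] {W B I : Finset α} {m : ℕ} (hB : B ⊆ W)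
    (hI : I ⊆ W) (hBI : Disjoint B I) (hm : I.card ≤ m) :
    ((W.powersetCard m).filter fun F => I ⊆ F ∧ Disjoint B F).card =
      (W.card - B.card - I.card).choose (m - I.card) := by
  have hc : ((W \ B) \ I).card = W.card - B.card - I.card := by
    rw [Finset.card_sdiff_of_subset, Finset.card_sdiff_of_subset hB]
    exact Finset.subset_sdiff.2 ⟨hI, hBI.symm⟩
  rw [← hc, ← Finset.card_powersetCard]
  refine Finset.card_nbij' (fun F => F \ I) (fun F => F ∪ I) ?_ ?_ ?_ ?_
  · intro F hF
    simp only [Finset.coe_filter, Finset.mem_powersetCard, Set.mem_ofPred_eq, Finset.mem_coe]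
      at hF ⊢
    obtain ⟨⟨hFW, hFm⟩, hIF, hBF⟩ := hF
    refine ⟨Finset.sdiff_subset_sdiff (Finset.subset_sdiff.2 ⟨hFW, hBF.symm⟩) subset_rfl, ?_⟩
    rw [Finset.card_sdiff_of_subset hIF, hFm]
  · intro F hF
    simp only [Finset.coe_filter, Finset.mem_powersetCard, Set.mem_ofPred_eq, Finset.mem_coe]
      at hF ⊢
    obtain ⟨hFW, hFm⟩ := hF
    obtain ⟨h1, h2⟩ := Finset.subset_sdiff.1 hFW
    obtain ⟨h3, h4⟩ := Finset.subset_sdiff.1 h1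
    refine ⟨⟨Finset.union_subset h3 hI, ?_⟩, Finset.subset_union_right,
      Finset.disjoint_union_right.2 ⟨h4.symm, hBI⟩⟩
    rw [Finset.card_union_of_disjoint h2, hFm]
    omega
  · intro F hF
    simp only [Finset.coe_filter, Set.mem_ofPred_eq] at hF
    exact Finset.sdiff_union_of_subset hF.2.1
  · intro F hF
    simp only [Finset.mem_powersetCard, Finset.mem_coe] at hF
    exact Finset.union_sdiff_cancel_right (Finset.subset_sdiff.1 hF.1).2

/-- Each `F` with `k` elements selects one pair, and the pairs selected have `I.card ≤ k`; so in a
finite set `W` containing all these pairs, double counting expresses `W.card.choose k` through the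
numbers of pairs with `I.card ≤ k`. -/
theorem card_eq_choose [Infinite α] {d : ℕ} (h : IsEmptySphereFamily (d + 1) P) (k : ℕ) :
    (h.finite_card_eq k).toFinset.card = (d + k).choose d := by
  classical
  induction k using Nat.strong_induction_on with
  | _ k ih =>
  let Q : ℕ → Finset (Finset α × Finset α) := fun j => (h.finite_card_eq j).toFinset
  have hQ : ∀ j p, p ∈ Q j ↔ p ∈ P ∧ p.2.card = j := fun j p => by simp [Q]
  let R := (Finset.range (k + 1)).biUnion Q
  let W₀ := R.biUnion fun p => p.1 ∪ p.2
  -- Adding `d + 1 + k` points makes the binomial coefficients below match the convolution identity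
  -- `sum_antidiagonal_choose_mul_choose` with `e = W₀.card`.
  obtain ⟨W, hW₀, hW⟩ :=
    Infinite.exists_superset_card_eq W₀ (d + W₀.card + 1 + k) (by omega)
  have hWp : ∀ j ≤ k, ∀ p ∈ Q j, p.1 ⊆ W ∧ p.2 ⊆ W := fun j hj p hp => by
    refine Finset.union_subset_iff.1 (subset_trans ?_ hW₀)
    refine Finset.subset_biUnion_of_mem (fun p : Finset α × Finset α => p.1 ∪ p.2) (x := p) ?_
    exact Finset.mem_biUnion.2 ⟨j, by simpa [Nat.lt_succ_iff] using hj, hp⟩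
  -- Double counting of the pairs `(F, p)` where `F ⊆ W` has `k` elements and `p` is selected by `F`.
  have hcount : (d + W₀.card + 1 + k).choose k =
      ∑ j ∈ Finset.range (k + 1), (Q j).card * (W₀.card + (k - j)).choose W₀.card := by
    calc (d + W₀.card + 1 + k).choose k
        = ∑ F ∈ W.powersetCard k, 1 := by simp [hW]
      _ = ∑ F ∈ W.powersetCard k, ∑ j ∈ Finset.range (k + 1),
            ((Q j).filter fun p => p.2 ⊆ F ∧ Disjoint p.1 F).card := by
          refine Finset.sum_congr rfl fun F hF => ?_
          obtain ⟨hFW, hFk⟩ := Finset.mem_powersetCard.1 hF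
          obtain ⟨p, ⟨hp, hpF, hpd⟩, huniq⟩ := h.existsUnique F
          have hpk := Finset.card_le_card hpF
          rw [Finset.sum_eq_single_of_mem p.2.card (by simp; omega)]
          · symm
            refine Finset.card_eq_one.2 ⟨p, Finset.ext fun q => ?_⟩
            simp only [Finset.mem_filter, hQ, Finset.mem_singleton]
            refine ⟨fun hq => huniq q ⟨hq.1.1, hq.2⟩, ?_⟩
            rintro rfl
            exact ⟨⟨hp, rfl⟩, hpF, hpd⟩
          · intro j _ hj
            refine Finset.card_eq_zero.2 (Finset.filter_eq_empty_iff.2 fun {q} hq hqF => hj ?_)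
            obtain ⟨hqP, hqj⟩ := (hQ j q).1 hq
            rw [← huniq q ⟨hqP, hqF⟩, hqj]
      _ = ∑ j ∈ Finset.range (k + 1), ∑ p ∈ Q j,
            ((W.powersetCard k).filter fun F => p.2 ⊆ F ∧ Disjoint p.1 F).card := by
          rw [Finset.sum_comm]
          refine Finset.sum_congr rfl fun j _ => ?_
          exact Finset.sum_card_bipartiteAbove_eq_sum_card_bipartiteBelow
            (fun (F : Finset α) (p : Finset α × Finset α) => p.2 ⊆ F ∧ Disjoint p.1 F)
      _ = _ := by
          refine Finset.sum_congr rfl fun j hj => ?_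
          have hjk : j ≤ k := by simpa [Nat.lt_succ_iff] using hj
          rw [Finset.card_eq_sum_ones, Finset.sum_mul]
          refine Finset.sum_congr rfl fun p hp => ?_
          obtain ⟨hpP, hpj⟩ := (hQ j p).1 hp
          obtain ⟨h1, h2⟩ := hWp j hjk p hp
          rw [card_filter_subset_disjoint h1 h2 (h.disjoint p hpP) (by omega), hW,
            h.card_fst p hpP, hpj, one_mul,
            show d + W₀.card + 1 + k - (d + 1) - j = W₀.card + (k - j) by omega]
          exact Nat.choose_symm_of_eq_add (by omega)
  have hid := sum_antidiagonal_choose_mul_choose d W₀.card k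
  rw [Finset.Nat.sum_antidiagonal_eq_sum_range_succ
    (fun i j => (d + i).choose d * (W₀.card + j).choose W₀.card), hcount,
    Finset.sum_range_succ, Finset.sum_range_succ] at hid
  have hlow : ∑ j ∈ Finset.range k, (Q j).card * (W₀.card + (k - j)).choose W₀.card =
      ∑ j ∈ Finset.range k, (d + j).choose d * (W₀.card + (k - j)).choose W₀.card :=
    Finset.sum_congr rfl fun j hj => by rw [← ih j (Finset.mem_range.1 hj)]
  rw [hlow] at hid
  simpa [Q] using hid.symm

end IsEmptySphereFamily

open scoped RealInnerProductSpace

/-! ### Thin Delone sets and general position -/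

section Hyperplanes

variable {d : ℕ} {A : Set (EuclideanSpace ℝ (Fin d))}

theorem IsLocallyFinite.mono {B : Set (EuclideanSpace ℝ (Fin d))} (hA : IsLocallyFinite A)
    (h : B ⊆ A) : IsLocallyFinite B :=
  fun c r => (hA c r).subset (Set.inter_subset_inter_left _ h)

theorem IsLocallyFinite.isClosed (hA : IsLocallyFinite A) : IsClosed A := by
  refine isClosed_of_closure_subset fun y hy => ?_
  have h := Metric.isOpen_ball.inter_closure ⟨Metric.mem_ball_self (x := y) one_pos, hy⟩
  have hfin : (Metric.ball y 1 ∩ A).Finite := (hA y 1).subset fun a ha =>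
    ⟨ha.2, Metric.ball_subset_closedBall ha.1⟩
  rw [hfin.isClosed.closure_eq] at h
  exact h.2

theorem IsCoarselyDense.diff_finset (hA : IsCoarselyDense A)
    (F : Finset (EuclideanSpace ℝ (Fin d))) : IsCoarselyDense (A \ ↑F) := by
  intro u c hu
  obtain ⟨M, hM⟩ := (F.image fun f => ⟪u, f⟫).bddAbove
  obtain ⟨a, ha, hac⟩ := hA u (max c (M + 1)) hu
  refine ⟨a, ⟨ha, fun haF => ?_⟩, (le_max_left _ _).trans hac⟩
  have := hM (Finset.mem_coe.2 (Finset.mem_image_of_mem (fun f => ⟪u, f⟫) (Finset.mem_coe.1 haF)))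
  linarith [(le_max_right c (M + 1)).trans hac]

theorem IsCoarselyDense.nonempty (hd : 1 ≤ d) (hA : IsCoarselyDense A) : A.Nonempty := by
  have : Nonempty (Fin d) := ⟨⟨0, hd⟩⟩
  obtain ⟨u, hu⟩ := exists_ne (0 : EuclideanSpace ℝ (Fin d))
  obtain ⟨a, ha, -⟩ := hA u 0 hu
  exact ⟨a, ha⟩

theorem IsCoarselyDense.infinite (hd : 1 ≤ d) (hA : IsCoarselyDense A) : A.Infinite := by
  intro hfin
  obtain ⟨a, ha, ha'⟩ := (hA.diff_finset hfin.toFinset).nonempty hd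
  exact ha' (by simpa using ha)

theorem exists_hyperplane_of_card_le (hd : 1 ≤ d) (S : Finset (EuclideanSpace ℝ (Fin d)))
    (hS : S.card ≤ d) :
    ∃ (u : EuclideanSpace ℝ (Fin d)) (c : ℝ), u ≠ 0 ∧ ∀ p ∈ S, ⟪u, p⟫ = c := by
  have : Nonempty (Fin d) := ⟨⟨0, hd⟩⟩
  rcases S.eq_empty_or_nonempty with rfl | ⟨p₀, hp₀⟩
  · obtain ⟨u, hu⟩ := exists_ne (0 : EuclideanSpace ℝ (Fin d))
    exact ⟨u, 0, hu, by simp⟩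
  have hrank : Module.finrank ℝ (vectorSpan ℝ (S : Set (EuclideanSpace ℝ (Fin d)))) < d := by
    have := finrank_vectorSpan_image_finset_le ℝ (id : EuclideanSpace ℝ (Fin d) → _) S
      (n := S.card - 1) (by have := Finset.card_pos.2 ⟨p₀, hp₀⟩; omega)
    rw [Finset.image_id] at this
    omega
  have hne : (vectorSpan ℝ (S : Set (EuclideanSpace ℝ (Fin d))))ᗮ ≠ ⊥ := fun h => by
    rw [Submodule.orthogonal_eq_bot_iff.1 h, finrank_top, finrank_euclideanSpace_fin] at hrank
    exact lt_irrefl _ hrank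
  obtain ⟨u, hu, hu0⟩ := Submodule.exists_mem_ne_zero_of_ne_bot hne
  refine ⟨u, ⟪u, p₀⟫, hu0, fun p hp => ?_⟩
  have := (Submodule.mem_orthogonal' _ _).1 hu _ (vsub_mem_vectorSpan ℝ (Finset.mem_coe.2 hp)
    (Finset.mem_coe.2 hp₀))
  rw [vsub_eq_sub, inner_sub_right] at this
  linarith

/-- A generic point lies in no convex hull of `d` or fewer points of `A`: such points can be
completed to `d` points of `A`, and these lie on a hyperplane, which would contain `x`. -/
theorem IsGenericWrt.lt_card_of_mem_convexHull {x : EuclideanSpace ℝ (Fin d)} (hd : 1 ≤ d)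
    (hinf : A.Infinite) (hx : IsGenericWrt x A) {S : Finset (EuclideanSpace ℝ (Fin d))}
    (hSA : (S : Set (EuclideanSpace ℝ (Fin d))) ⊆ A)
    (hxS : x ∈ convexHull ℝ (S : Set (EuclideanSpace ℝ (Fin d)))) : d < S.card := by
  classical
  by_contra! hS
  obtain ⟨S', hS'A, hS'⟩ := (hinf.sdiff S.finite_toSet).exists_subset_card_eq (d - S.card)
  have hdisj : Disjoint S S' :=
    Finset.disjoint_left.2 fun a ha ha' => (hS'A (Finset.mem_coe.2 ha')).2 ha
  have hcard : (S ∪ S').card = d := by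
    rw [Finset.card_union_of_disjoint hdisj, hS']
    omega
  have hsub : ((S ∪ S' : Finset _) : Set (EuclideanSpace ℝ (Fin d))) ⊆ A := by
    rw [Finset.coe_union]
    exact Set.union_subset hSA (hS'A.trans Set.sdiff_subset)
  obtain ⟨u, c, hu, hc⟩ := exists_hyperplane_of_card_le hd _ hcard.le
  have hxc : ⟪u, x⟫ = c := by
    have hconv : Convex ℝ {y : EuclideanSpace ℝ (Fin d) | ⟪u, y⟫ = c} :=
      convex_hyperplane (innerₛₗ ℝ u).isLinear c
    exact convexHull_min (fun p hp => hc p (Finset.mem_union_left _ hp)) hconv hxS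
  refine hx.2.hyperplane (insert x (S ∪ S')) ?_ ?_ u c hu ?_
  · rw [Finset.coe_insert, Set.union_singleton]
    exact Set.insert_subset_insert hsub
  · rw [Finset.card_insert_of_notMem fun h => hx.1 (hsub h), hcard]
  · intro p hp
    rcases Finset.mem_insert.1 hp with rfl | hp
    exacts [hxc, hc p hp]

end Hyperplanes

/-! ### Uniqueness of the empty simplex -/

section Uniqueness

variable {d : ℕ} {A : Set (EuclideanSpace ℝ (Fin d))}

/-- If `x` is a convex combination of points at which an affine function is nonnegative, while the
function is nonpositive at `x`, then only points where it vanishes have nonzero weight. -/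
theorem mem_convexHull_filter_eq_zero {E : Type*} [AddCommGroup E] [Module ℝ E] {S : Finset E}
    {x : E} (hx : x ∈ convexHull ℝ (S : Set E)) (f : E →ᵃ[ℝ] ℝ) (hf : ∀ p ∈ S, 0 ≤ f p)
    (hfx : f x ≤ 0) : x ∈ convexHull ℝ ((S.filter fun p => f p = 0 : Finset E) : Set E) := by
  classical
  obtain ⟨w, hw, hw1, rfl⟩ := Finset.mem_convexHull.1 hx
  have hsum : ∑ p ∈ S, w p * f p ≤ 0 := by
    rw [← affineCombination_eq_centerMass hw1, Finset.map_affineCombination _ _ _ hw1,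
      Finset.affineCombination_eq_linear_combination _ _ _ hw1] at hfx
    simpa using hfx
  have hzero : ∀ p ∈ S, w p * f p = 0 :=
    (Finset.sum_eq_zero_iff_of_nonneg fun p hp => mul_nonneg (hw p hp) (hf p hp)).1
      (hsum.antisymm (Finset.sum_nonneg fun p hp => mul_nonneg (hw p hp) (hf p hp)))
  rw [← Finset.centerMass_filter_ne_zero]
  refine Finset.centerMass_mem_convexHull _ (fun p hp => hw p (Finset.mem_filter.1 hp).1) ?_ ?_
  · rw [Finset.sum_filter_ne_zero, hw1]
    exact one_pos
  · intro p hp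
    obtain ⟨hpS, hwp⟩ := Finset.mem_filter.1 hp
    simpa [hpS] using (mul_eq_zero.1 (hzero p hpS)).resolve_left hwp

/-- The difference of the powers of a point with respect to two spheres is affine. -/
theorem exists_affineMap_eq_power_sub_power {E : Type*} [NormedAddCommGroup E]
    [InnerProductSpace ℝ E] (z₁ z₂ : E) (r₁ r₂ : ℝ) :
    ∃ f : E →ᵃ[ℝ] ℝ, ∀ y, f y = (dist y z₂ ^ 2 - r₂ ^ 2) - (dist y z₁ ^ 2 - r₁ ^ 2) := by
  refine ⟨(innerₛₗ ℝ ((2 : ℝ) • (z₁ - z₂))).toAffineMap +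
    AffineMap.const ℝ E (‖z₂‖ ^ 2 - r₂ ^ 2 - (‖z₁‖ ^ 2 - r₁ ^ 2)), fun y => ?_⟩
  simp only [AffineMap.coe_add, Pi.add_apply, LinearMap.coe_toAffineMap, AffineMap.coe_const,
    Function.const_apply, dist_eq_norm, @norm_sub_sq_real, innerₛₗ_apply_apply, real_inner_comm y,
    inner_smul_right, inner_sub_right]
  ring

/-- The spheres need not be empty with respect to `A`: it suffices that neither contains one of the
`d + 1` points of the other one in its inside. -/
theorem IsGeneric.eq_of_empty_spheres {x : EuclideanSpace ℝ (Fin d)} (hd : 1 ≤ d)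
    (hinf : A.Infinite) (hgen : IsGeneric A) (hx : IsGenericWrt x A)
    {B₁ B₂ : Finset (EuclideanSpace ℝ (Fin d))} (hB₁ : (B₁ : Set (EuclideanSpace ℝ (Fin d))) ⊆ A)
    (hB₂ : (B₂ : Set (EuclideanSpace ℝ (Fin d))) ⊆ A) (hc₁ : B₁.card = d + 1)
    (hc₂ : B₂.card = d + 1) {z₁ z₂ : EuclideanSpace ℝ (Fin d)} {r₁ r₂ : ℝ} (hr₁ : 0 ≤ r₁)
    (hr₂ : 0 < r₂) (hs₁ : ∀ b ∈ B₁, dist b z₁ = r₁) (hs₂ : ∀ b ∈ B₂, dist b z₂ = r₂)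
    (he₁ : ∀ b ∈ B₂, r₁ ≤ dist b z₁) (he₂ : ∀ b ∈ B₁, r₂ ≤ dist b z₂)
    (hx₁ : x ∈ convexHull ℝ (B₁ : Set (EuclideanSpace ℝ (Fin d))))
    (hx₂ : x ∈ convexHull ℝ (B₂ : Set (EuclideanSpace ℝ (Fin d)))) : B₁ = B₂ := by
  classical
  obtain ⟨f, hf⟩ := exists_affineMap_eq_power_sub_power z₁ z₂ r₁ r₂
  have hf₁ : ∀ b ∈ B₁, 0 ≤ f b := fun b hb => by
    rw [hf, hs₁ b hb]
    have := pow_le_pow_left₀ hr₂.le (he₂ b hb) 2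
    linarith
  have hfx : f x ≤ 0 := by
    have hconv : Convex ℝ (f ⁻¹' Set.Iic 0) := (convex_Iic 0).affine_preimage f
    refine convexHull_min (fun b hb => ?_) hconv hx₂
    rw [Set.mem_preimage, Set.mem_Iic, hf, hs₂ b hb]
    have := pow_le_pow_left₀ hr₁ (he₁ b hb) 2
    linarith
  have hmem := mem_convexHull_filter_eq_zero hx₁ f hf₁ hfx
  have hlt := hx.lt_card_of_mem_convexHull hd hinf
    ((Finset.coe_subset.2 (Finset.filter_subset _ _)).trans hB₁) hmem
  have hfilter : B₁.filter (fun p => f p = 0) = B₁ :=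
    Finset.eq_of_subset_of_card_le (Finset.filter_subset _ _) (by omega)
  have hs : ∀ b ∈ B₁, dist b z₂ = r₂ := fun b hb => by
    have h0 := (Finset.mem_filter.1 (hfilter.symm ▸ hb)).2
    rw [hf, hs₁ b hb] at h0
    exact (pow_left_inj₀ dist_nonneg hr₂.le two_ne_zero).1 (by linarith)
  by_contra hne
  obtain ⟨b, hb₁, hb₂⟩ := Finset.not_subset.1 fun hsub =>
    hne (Finset.eq_of_subset_of_card_le hsub (by omega))
  refine hgen.sphere (insert b B₂) ?_ (by rw [Finset.card_insert_of_notMem hb₂, hc₂]) z₂ r₂ hr₂ ?_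
  · rw [Finset.coe_insert]
    exact Set.insert_subset (hB₁ hb₁) hB₂
  · intro p hp
    rcases Finset.mem_insert.1 hp with rfl | hp
    exacts [hs p hb₁, hs₂ p hp]

end Uniqueness

/-! ### Existence of an empty sphere around a point -/

section Existence

variable {d : ℕ} {A : Set (EuclideanSpace ℝ (Fin d))}

/-- By compactness of the unit sphere finitely many points of `A` meet all the half-spaces
`{a | 1 < ⟪u, a - x⟫}` with `u` a unit vector. Hence an empty sphere with `x` on it or inside it has
its centre at bounded distance from `x`. -/
theorem IsCoarselyDense.exists_forall_power_lt (hA : IsCoarselyDense A)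
    (x : EuclideanSpace ℝ (Fin d)) :
    ∃ R, ∀ z, R < dist z x → ∃ a ∈ A, dist z a ^ 2 - dist z x ^ 2 < 0 := by
  obtain ⟨t, ht⟩ := (isCompact_sphere (0 : EuclideanSpace ℝ (Fin d)) 1).elim_finite_subcover
    (fun a : A => {u | 1 < ⟪u, (a : EuclideanSpace ℝ (Fin d)) - x⟫})
    (fun a => isOpen_lt continuous_const (by fun_prop)) fun u hu => by
      obtain ⟨a, ha, hau⟩ := hA u (⟪u, x⟫ + 2) (by rintro rfl; simp at hu)
      refine Set.mem_iUnion.2 ⟨⟨a, ha⟩, ?_⟩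
      simp only [Set.mem_ofPred_eq, inner_sub_right]
      linarith
  refine ⟨∑ a ∈ t, ‖(a : EuclideanSpace ℝ (Fin d)) - x‖ ^ 2, fun z hz => ?_⟩
  have hR : ∀ a ∈ t, ‖(a : EuclideanSpace ℝ (Fin d)) - x‖ ^ 2 < dist z x := fun a ha =>
    (Finset.single_le_sum (f := fun a : A => ‖(a : EuclideanSpace ℝ (Fin d)) - x‖ ^ 2)
      (fun _ _ => sq_nonneg _) ha).trans_lt hz
  have hpos : 0 < ‖z - x‖ := by
    rw [← dist_eq_norm]
    exact (Finset.sum_nonneg fun _ _ => sq_nonneg _).trans_lt hz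
  have hu : ‖z - x‖⁻¹ • (z - x) ∈ Metric.sphere (0 : EuclideanSpace ℝ (Fin d)) 1 := by
    simp [norm_smul, hpos.ne']
  obtain ⟨a, ha, hau⟩ := Set.mem_iUnion₂.1 (ht hu)
  refine ⟨a, a.2, ?_⟩
  simp only [Set.mem_ofPred_eq, inner_smul_left, conj_trivial] at hau
  rw [← div_eq_inv_mul, one_lt_div hpos] at hau
  have := hR a ha
  rw [dist_eq_norm] at this ⊢
  rw [dist_eq_norm, show z - (a : EuclideanSpace ℝ (Fin d)) = (z - x) - (a - x) by abel,
    norm_sub_sq_real]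
  linarith

/-- Among the spheres that have no point of `A` inside, take one whose power at `x` is least. If `x`
were separated from the points of `A` on the sphere, then moving the centre away from those points
would decrease the power further. -/
theorem IsThinDelone.exists_empty_sphere (hd : 1 ≤ d) (hA : IsThinDelone A)
    {x : EuclideanSpace ℝ (Fin d)} (hx : x ∉ A) :
    ∃ z r, 0 < r ∧ (∀ a ∈ A, r ≤ dist a z) ∧ x ∈ convexHull ℝ (A ∩ Metric.sphere z r) := by
  have hcl := hA.locallyFinite.isClosed
  have hne := hA.coarselyDense.nonempty hd
  obtain ⟨R, hR⟩ := hA.coarselyDense.exists_forall_power_lt x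
  -- `-φ z` is the power of `x` with respect to the largest empty sphere around `z`.
  set φ : EuclideanSpace ℝ (Fin d) → ℝ := fun z => Metric.infDist z A ^ 2 - dist z x ^ 2 with hφ
  have hφa : ∀ z, ∀ a ∈ A, φ z ≤ dist z a ^ 2 - dist z x ^ 2 := fun z a ha =>
    sub_le_sub_right (pow_le_pow_left₀ Metric.infDist_nonneg (Metric.infDist_le_dist_of_mem ha) 2) _
  have hφcont : Continuous φ := by
    have := Metric.continuous_infDist_pt A
    fun_prop
  have hφx : 0 < φ x := by
    have := (hcl.notMem_iff_infDist_pos hne).1 hx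
    simp only [hφ, dist_self]
    rw [zero_pow two_ne_zero, sub_zero]
    exact pow_pos this 2
  obtain ⟨z, hz⟩ := hφcont.exists_forall_ge' x <| by
    filter_upwards [(isCompact_closedBall x R).compl_mem_cocompact] with z hz
    obtain ⟨a, ha, haz⟩ := hR z (by simpa using hz)
    linarith [hφa z a ha]
  set r := Metric.infDist z A with hr
  have hrpos : 0 < r := by
    have h1 := hz x
    have h2 : 0 < r ^ 2 := by
      have : φ z = r ^ 2 - dist z x ^ 2 := rfl
      nlinarith [sq_nonneg (dist z x)]
    exact Metric.infDist_nonneg.lt_of_ne fun h => by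
      rw [← hr] at h
      simp [← h] at h2
  refine ⟨z, r, hrpos, fun a ha => ?_, ?_⟩
  · rw [dist_comm]
    exact Metric.infDist_le_dist_of_mem ha
  by_contra hxB
  have hBfin : (A ∩ Metric.sphere z r).Finite := (hA.locallyFinite z r).subset
    (Set.inter_subset_inter_right _ Metric.sphere_subset_closedBall)
  obtain ⟨f, s, hfx, hfB⟩ := geometric_hahn_banach_point_closed (convex_convexHull ℝ _)
    (hBfin.isClosed_convexHull ℝ) hxB
  obtain ⟨v, hv⟩ := (InnerProductSpace.toDual ℝ (EuclideanSpace ℝ (Fin d))).surjective f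
  have hvf : ∀ y, f y = ⟪v, y⟫ := fun y => by rw [← hv, InnerProductSpace.toDual_apply_apply]
  have hpow : ∀ (t : ℝ) (a : EuclideanSpace ℝ (Fin d)),
      dist (z - t • v) a ^ 2 - dist (z - t • v) x ^ 2 =
        dist z a ^ 2 - dist z x ^ 2 + 2 * t * ⟪v, a - x⟫ := fun t a => by
    simp only [dist_eq_norm]
    rw [show z - t • v - a = (z - a) - t • v by abel, show z - t • v - x = (z - x) - t • v by abel,
      norm_sub_sq_real, norm_sub_sq_real (z - x)]
    simp only [inner_smul_right, inner_sub_right, real_inner_comm v]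
    ring
  -- For a small `t > 0`, replacing `z` by `z - t • v` brings the right-hand side of `hφa` above
  -- `φ z` for all points `a ∈ A` in a ball that contains the point of `A` nearest to `z - t • v`.
  have hev : ∀ᶠ t : ℝ in nhdsWithin 0 (Set.Ioi 0), ∀ a ∈ A ∩ Metric.closedBall z (r + 2 * ‖v‖),
      φ z < dist z a ^ 2 - dist z x ^ 2 + 2 * t * ⟪v, a - x⟫ := by
    refine (Filter.eventually_all_finite (hA.locallyFinite _ _)).2 fun a ha => ?_
    by_cases haB : a ∈ Metric.sphere z r
    · filter_upwards [self_mem_nhdsWithin] with t ht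
      have h1 := hfB a (subset_convexHull ℝ _ ⟨ha.1, haB⟩)
      rw [hvf] at h1 hfx
      have h2 : 0 < ⟪v, a - x⟫ := by
        rw [inner_sub_right]
        linarith
      have h3 : dist z a = r := by rw [dist_comm]; exact haB
      have h4 : 0 < 2 * t * ⟪v, a - x⟫ := by
        have : 0 < t := ht
        positivity
      rw [h3]
      change r ^ 2 - dist z x ^ 2 < _
      linarith
    · refine Filter.Eventually.filter_mono nhdsWithin_le_nhds ?_
      have hcont : ContinuousAt
          (fun t : ℝ => dist z a ^ 2 - dist z x ^ 2 + 2 * t * ⟪v, a - x⟫) 0 := by fun_prop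
      refine hcont.eventually_const_lt ?_
      have h1 : r < dist z a := lt_of_le_of_ne (Metric.infDist_le_dist_of_mem ha.1) fun h =>
        haB (by rw [Metric.mem_sphere, dist_comm, h])
      have h2 := pow_lt_pow_left₀ h1 hrpos.le two_ne_zero
      change r ^ 2 - dist z x ^ 2 < _
      linarith
  obtain ⟨t, ht, ht1, ht0⟩ := (hev.and
    ((Filter.Eventually.filter_mono nhdsWithin_le_nhds (eventually_lt_nhds one_pos)).and
      self_mem_nhdsWithin)).exists
  obtain ⟨a, ha, haz⟩ := hcl.exists_infDist_eq_dist hne (z - t • v)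
  have hstep : dist (z - t • v) z ≤ ‖v‖ := by
    have ht0' : (0 : ℝ) < t := ht0
    rw [dist_eq_norm, show z - t • v - z = -(t • v) by abel, norm_neg, norm_smul,
      Real.norm_of_nonneg ht0'.le]
    exact mul_le_of_le_one_left (norm_nonneg v) ht1.le
  have hnear : a ∈ Metric.closedBall z (r + 2 * ‖v‖) := by
    have h1 : Metric.infDist (z - t • v) A ≤ r + dist (z - t • v) z :=
      Metric.infDist_le_infDist_add_dist
    rw [haz] at h1
    have h2 := dist_triangle_left a z (z - t • v)
    rw [Metric.mem_closedBall]
    linarith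
  have h1 := ht a ⟨ha, hnear⟩
  rw [← hpow, ← haz] at h1
  exact absurd (hz (z - t • v)) (not_le.2 h1)

end Existence

/-! ### Simplices as pairs of vertex sets and sets of inner points -/

section HeftyPairs

variable {d : ℕ} {A : Set (EuclideanSpace ℝ (Fin d))}

/-- The pairs `(B, I)` where `B` is the vertex set of a `d`-simplex with vertices in `A` that
contains `x`, and `I` is the finite set of points of `A` inside its circumscribed sphere. -/
def heftyPairs (A : Set (EuclideanSpace ℝ (Fin d))) (x : EuclideanSpace ℝ (Fin d)) :
    Set (Finset (EuclideanSpace ℝ (Fin d)) × Finset (EuclideanSpace ℝ (Fin d))) :=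
  {p | ∃ T : Affine.Simplex ℝ (EuclideanSpace ℝ (Fin d)) d,
    Set.range T.points = ↑p.1 ∧ Set.range T.points ⊆ A ∧
      A ∩ Metric.ball T.circumcenter T.circumradius = ↑p.2 ∧
        x ∈ convexHull ℝ (p.1 : Set (EuclideanSpace ℝ (Fin d)))}

theorem Affine.Simplex.ball_eq_of_range_eq {n : ℕ}
    {T T' : Affine.Simplex ℝ (EuclideanSpace ℝ (Fin d)) n}
    (h : Set.range T.points = Set.range T'.points) :
    Metric.ball T.circumcenter T.circumradius = Metric.ball T'.circumcenter T'.circumradius := by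
  have hmem : T.circumcenter ∈ affineSpan ℝ (Set.range T'.points) :=
    h ▸ T.circumcenter_mem_affineSpan
  have hdist : ∀ i, dist (T'.points i) T.circumcenter = T.circumradius := fun i => by
    obtain ⟨j, hj⟩ : T'.points i ∈ Set.range T.points := h ▸ Set.mem_range_self i
    rw [← hj, T.dist_circumcenter_eq_circumradius]
  rw [T'.eq_circumcenter_of_dist_eq hmem hdist, T'.eq_circumradius_of_dist_eq hmem hdist]

theorem snd_eq_of_mem_heftyPairs {x : EuclideanSpace ℝ (Fin d)}
    {p q : Finset (EuclideanSpace ℝ (Fin d)) × Finset (EuclideanSpace ℝ (Fin d))}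
    (hp : p ∈ heftyPairs A x) (hq : q ∈ heftyPairs A x) (h : p.1 = q.1) : p.2 = q.2 := by
  obtain ⟨T, hT, -, hTI, -⟩ := hp
  obtain ⟨T', hT', -, hT'I, -⟩ := hq
  have hball := Affine.Simplex.ball_eq_of_range_eq (T := T) (T' := T') (by rw [hT, hT', h])
  rw [← Finset.coe_inj, ← hTI, ← hT'I, hball]

theorem card_fst_of_mem_heftyPairs {x : EuclideanSpace ℝ (Fin d)}
    {p : Finset (EuclideanSpace ℝ (Fin d)) × Finset (EuclideanSpace ℝ (Fin d))}
    (hp : p ∈ heftyPairs A x) : p.1.card = d + 1 := by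
  obtain ⟨T, hT, -⟩ := hp
  rw [← Set.ncard_coe_finset, ← hT, ← Set.image_univ,
    Set.ncard_image_of_injective _ T.independent.injective, Set.ncard_univ, Nat.card_fin]

theorem exists_sphere_of_mem_heftyPairs (hd : 1 ≤ d) {x : EuclideanSpace ℝ (Fin d)}
    {p : Finset (EuclideanSpace ℝ (Fin d)) × Finset (EuclideanSpace ℝ (Fin d))}
    (hp : p ∈ heftyPairs A x) :
    ∃ z r, 0 < r ∧ (∀ b ∈ p.1, dist b z = r) ∧ (p.1 : Set (EuclideanSpace ℝ (Fin d))) ⊆ A ∧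
      (∀ a ∈ A, a ∉ p.2 → r ≤ dist a z) ∧ (∀ a ∈ p.2, dist a z < r) ∧
        x ∈ convexHull ℝ (p.1 : Set (EuclideanSpace ℝ (Fin d))) := by
  obtain ⟨T, hT, hTA, hTI, hx⟩ := hp
  refine ⟨T.circumcenter, T.circumradius, ?_, fun b hb => ?_, hT ▸ hTA, fun a ha haI => ?_,
    fun a ha => ?_, hx⟩
  · obtain ⟨n, rfl⟩ : ∃ n, d = n + 1 := ⟨d - 1, by omega⟩
    exact T.circumradius_pos
  · obtain ⟨i, rfl⟩ : b ∈ Set.range T.points := hT ▸ hb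
    exact T.dist_circumcenter_eq_circumradius i
  · by_contra! hlt
    exact haI (Finset.mem_coe.1 (hTI ▸ ⟨ha, hlt⟩))
  · have : a ∈ A ∩ Metric.ball T.circumcenter T.circumradius := hTI ▸ ha
    exact this.2

/-- Existence of a Delaunay simplex of `A \ F` that contains `x`. -/
theorem exists_mem_heftyPairs (hd : 1 ≤ d) (hA : IsThinDelone A) {x : EuclideanSpace ℝ (Fin d)}
    (hx : IsGenericWrt x A) (F : Finset (EuclideanSpace ℝ (Fin d))) :
    ∃ p ∈ heftyPairs A x, p.2 ⊆ F ∧ Disjoint p.1 F := by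
  have hAF : IsThinDelone (A \ ↑F) :=
    ⟨hA.locallyFinite.mono Set.sdiff_subset, hA.coarselyDense.diff_finset F⟩
  obtain ⟨z, r, -, hempty, hmem⟩ := hAF.exists_empty_sphere hd fun h => hx.1 h.1
  rw [convexHull_eq_union] at hmem
  simp only [Set.mem_iUnion] at hmem
  obtain ⟨B, hB, hind, hxB⟩ := hmem
  have hBA : (B : Set (EuclideanSpace ℝ (Fin d))) ⊆ A := fun b hb => (hB hb).1.1
  have hcard : B.card = d + 1 := by
    have h1 := hx.lt_card_of_mem_convexHull hd (hA.coarselyDense.infinite hd) hBA hxB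
    have h2 := hind.card_le_finrank_succ
    have h3 := Submodule.finrank_le
      (vectorSpan ℝ (Set.range (Subtype.val : B → EuclideanSpace ℝ (Fin d))))
    rw [finrank_euclideanSpace_fin] at h3
    rw [Fintype.card_coe] at h2
    omega
  let e : Fin (d + 1) ≃ B := (Finset.equivFinOfCardEq hcard).symm
  let T : Affine.Simplex ℝ (EuclideanSpace ℝ (Fin d)) d :=
    ⟨fun i => (e i : EuclideanSpace ℝ (Fin d)), hind.comp_embedding e.toEmbedding⟩
  have hT : Set.range T.points = ↑B := by
    change Set.range (Subtype.val ∘ e) = _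
    rw [e.surjective.range_comp, Subtype.range_coe]
  have hspan : z ∈ affineSpan ℝ (Set.range T.points) := by
    rw [T.independent.affineSpan_eq_top_iff_card_eq_finrank_add_one.2 (by simp)]
    exact AffineSubspace.mem_top _ _ _
  have hdist : ∀ i, dist (T.points i) z = r := fun i => (hB (e i).2).2
  have hfin : (A ∩ Metric.ball z r).Finite := (hA.locallyFinite z r).subset
    (Set.inter_subset_inter_right _ Metric.ball_subset_closedBall)
  refine ⟨(B, hfin.toFinset), ⟨T, hT, hT ▸ hBA, ?_, hxB⟩, fun a ha => ?_, ?_⟩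
  · rw [← T.eq_circumcenter_of_dist_eq hspan hdist, ← T.eq_circumradius_of_dist_eq hspan hdist,
      hfin.coe_toFinset]
  · obtain ⟨haA, har⟩ := hfin.mem_toFinset.1 ha
    by_contra haF
    exact absurd (hempty a ⟨haA, haF⟩) (not_le.2 har)
  · exact Finset.disjoint_left.2 fun b hb => (hB hb).1.2

/-- Delaunay's theorem for all the sets `A \ F` with `F` finite. -/
theorem isEmptySphereFamily_heftyPairs (hd : 1 ≤ d) (hA : IsThinDelone A) (hgen : IsGeneric A)
    {x : EuclideanSpace ℝ (Fin d)} (hx : IsGenericWrt x A) :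
    IsEmptySphereFamily (d + 1) (heftyPairs A x) where
  card_fst _ hp := card_fst_of_mem_heftyPairs hp
  disjoint p hp := by
    obtain ⟨z, r, -, hs, -, -, hI, -⟩ := exists_sphere_of_mem_heftyPairs hd hp
    exact Finset.disjoint_left.2 fun b hb hb' => (hI b hb').ne (hs b hb)
  existsUnique F := by
    obtain ⟨p, hp, hpF, hpd⟩ := exists_mem_heftyPairs hd hA hx F
    refine ⟨p, ⟨hp, hpF, hpd⟩, fun q ⟨hq, hqF, hqd⟩ => ?_⟩
    obtain ⟨z₁, r₁, hr₁, hs₁, hA₁, he₁, -, hx₁⟩ := exists_sphere_of_mem_heftyPairs hd hp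
    obtain ⟨z₂, r₂, hr₂, hs₂, hA₂, he₂, -, hx₂⟩ := exists_sphere_of_mem_heftyPairs hd hq
    have h : q.1 = p.1 := hgen.eq_of_empty_spheres hd (hA.coarselyDense.infinite hd) hx hA₂ hA₁
      (card_fst_of_mem_heftyPairs hq) (card_fst_of_mem_heftyPairs hp) hr₂.le hr₁ hs₂ hs₁
      (fun b hb => he₂ b (hA₁ hb) fun h => Finset.disjoint_left.1 hpd hb (hqF h))
      (fun b hb => he₁ b (hA₂ hb) fun h => Finset.disjoint_left.1 hqd hb (hpF h)) hx₂ hx₁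
    exact Prod.ext h (snd_eq_of_mem_heftyPairs hq hp h)

theorem heftySimplicesContaining_eq_image (k : ℕ) (x : EuclideanSpace ℝ (Fin d)) :
    heftySimplicesContaining A k x =
      (fun p : Finset (EuclideanSpace ℝ (Fin d)) × Finset (EuclideanSpace ℝ (Fin d)) =>
        (p.1 : Set (EuclideanSpace ℝ (Fin d)))) '' {p ∈ heftyPairs A x | p.2.card = k} := by
  ext V
  constructor
  · rintro ⟨T, rfl, ⟨hTA, hk⟩, hx⟩
    have hfin := Set.finite_of_encard_eq_coe hk
    have hr := Set.finite_range T.points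
    refine ⟨(hr.toFinset, hfin.toFinset), ⟨⟨T, ?_, hTA, ?_, ?_⟩, ?_⟩, ?_⟩
    · simp
    · simp
    · simpa using hx
    · rw [hfin.encard_eq_coe_toFinset_card] at hk
      exact_mod_cast hk
    · simp
  · rintro ⟨p, ⟨⟨T, hT, hTA, hI, hx⟩, hk⟩, rfl⟩
    exact ⟨T, hT, ⟨hTA, by rw [hI, Set.encard_coe_eq_coe_finsetCard, hk]⟩, hx⟩

end HeftyPairs

theorem theorem2p2 (d : ℕ) (hd : 1 ≤ d) (k : ℕ) (A : Set (EuclideanSpace ℝ (Fin d)))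
    (hA : IsThinDelone A) (hgen : IsGeneric A)
    (x : EuclideanSpace ℝ (Fin d)) (hx : IsGenericWrt x A) :
    (heftySimplicesContaining A k x).encard = ((d + k).choose d : ℕ) := by
  have h := isEmptySphereFamily_heftyPairs hd hA hgen hx
  have : Infinite (EuclideanSpace ℝ (Fin d)) :=
    Set.infinite_univ_iff.1 ((hA.coarselyDense.infinite hd).mono (Set.subset_univ A))
  rw [heftySimplicesContaining_eq_image, Set.InjOn.encard_image,
    (h.finite_card_eq k).encard_eq_coe_toFinset_card, h.card_eq_choose]
  rintro p ⟨hp, -⟩ q ⟨hq, -⟩ hpq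
  have hpq : p.1 = q.1 := Finset.coe_injective hpq
  exact Prod.ext hpq (snd_eq_of_mem_heftyPairs hp hq hpq)
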